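/- Let $G$ be a finite group and $K=\mathbb{F}_2$. A $G$-code is a right ideal $\mathcal{C}\le KG$ of the group algebra. For $a=\sum_g a_g g$ and $b=\sum_g b_g g$ in $KG$ put $a*b=\sum_g a_gb_g\,g$ and $\langle a,b\rangle=\sum_g a_gb_g$; let $\mathcal{C}*\mathcal{C}$ be the $K$-linear span of all $c*c'$ with $c,c'\in\mathcal{C}$, and call $\mathcal{C}$ self-orthogonal if $\langle c,c'\rangle=0$ for all $c,c'\in\mathcal{C}$. For a subgroup $H\le G$ let $K_H^G=\bigl(\sum_{h\in H}h\bigr)KG$ be the right ideal spanned over $K$ by the elements $\sum_{h\in H}hg$, $g\in G$ (the module induced from the trivial $KH$-module). Let $\mathcal{P}_0\le KG$ be a right ideal that is a projective cover of the trivial right $KG$-module, and suppose that $\mathcal{P}_0=K_H^G$ for some subgroup $H\le G$. If $\mathcal{C}\le KG$ is a $G$-code that is not self-orthogonal, then $$\mathcal{C}*\mathcal{C}=\mathcal{P}_0\iff \mathcal{C}\le\mathcal{P}_0 .$$ The assumption on $\mathcal{P}_0$ can be satisfied, for instance, if $G$ has a normal $2$-complement $H$ (a normal subgroup of odd order and $2$-power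 index): in that case $K_H^G$ is a projective cover of the trivial $KG$-module. -/

import Mathlib

open scoped MonoidAlgebra

noncomputable section

namespace GCode

/-- `G`-codes over `K`: right ideals of the group algebra `KG`, that is, submodules of the
right regular `KG`-module. Right `KG`-modules are modules over the opposite ring `(KG)ᵐᵒᵖ`,
with `c · a = MulOpposite.op a • c`. -/
abbrev RightIdeal (K G : Type*) [Field K] [Group G] : Type _ :=
  Submodule (K[G])ᵐᵒᵖ K[G]

section Products

variable {K G : Type*} [Field K] [Group G] [Fintype G]

/-- The coefficientwise (Schur) product of two elements of `KG`. -/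
def schurMul (a b : K[G]) : K[G] :=
  ∑ g : G, MonoidAlgebra.single g (a.coeff g * b.coeff g)

/-- The Schur product `C * C'` of two codes: the `K`-linear span of all products `c * c'`. -/
def schurProduct (C D : Submodule K K[G]) : Submodule K K[G] :=
  Submodule.span K {x | ∃ c ∈ C, ∃ d ∈ D, x = schurMul c d}

/-- The standard inner product of two elements of `KG`. -/
def innerProduct (a b : K[G]) : K :=
  ∑ g : G, a.coeff g * b.coeff g

/-- A code is self-orthogonal if it is contained in its dual
`{v | ⟨v, c⟩ = 0 for all codewords c}`. -/
def IsSelfOrthogonal (C : Submodule K K[G]) : Prop :=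
  (C : Set K[G]) ⊆ {v | ∀ c ∈ C, innerProduct v c = 0}

open Classical in
/-- The sum in `KG` of the elements of a subgroup `H`; it spans the trivial `KH`-module inside
`KH`. -/
def subgroupSum (K : Type*) [Field K] (H : Subgroup G) : K[G] :=
  ∑ h : G with h ∈ H, MonoidAlgebra.single h (1 : K)

/-- The right ideal `K_H^G = ⨁ᵢ (K ∑_{h ∈ H} h) gᵢ` of `KG`, where the `gᵢ` form a right
transversal of `H` in `G`: the module induced from the trivial `KH`-module. It is given here as
the right ideal generated by `∑_{h ∈ H} h`; see `inducedTrivial_restrictScalars`. -/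
def inducedTrivial (K : Type*) [Field K] (H : Subgroup G) : RightIdeal K G :=
  Submodule.span (K[G])ᵐᵒᵖ {subgroupSum K H}

end Products

/-- The augmentation `KG → K`, `∑ a_g g ↦ ∑ a_g`. -/
def augmentation (K G : Type*) [Field K] [Group G] : K[G] →ₐ[K] K :=
  MonoidAlgebra.lift K K G (1 : G →* K)

/-- The trivial right `KG`-module: the vector space `K`, every element of `G` acting as the
identity. -/
def TrivialModule (K _G : Type*) : Type _ := K

instance TrivialModule.instAddCommGroup (K G : Type*) [Field K] :
    AddCommGroup (TrivialModule K G) :=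
  inferInstanceAs (AddCommGroup K)

instance TrivialModule.instModule (K G : Type*) [Field K] [Group G] :
    Module (K[G])ᵐᵒᵖ (TrivialModule K G) :=
  Module.compHom K
    ((augmentation K G : K[G] →+* K).fromOpposite fun _ _ => mul_comm _ _)

/-- A surjective linear map `π : P → M` from a projective module whose kernel is superfluous
(a submodule `N` with `ker π + N = P` is all of `P`): a projective cover of `M`. -/
structure IsProjectiveCover {R P M : Type*} [Ring R] [AddCommGroup P] [Module R P]
    [AddCommGroup M] [Module R M] (π : P →ₗ[R] M) : Prop where
  projective : Module.Projective R P
  surjective : Function.Surjective π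
  superfluous : ∀ N : Submodule R P, LinearMap.ker π ⊔ N = ⊤ → N = ⊤

/-- The right ideal `P` is (with a suitable map) a projective cover of the trivial module. -/
def IsProjectiveCoverOfTrivial {K G : Type*} [Field K] [Group G] (P : RightIdeal K G) : Prop :=
  ∃ π : P →ₗ[(K[G])ᵐᵒᵖ] TrivialModule K G, IsProjectiveCover π

/-- `H` is a normal `p`-complement of the finite group `G`: a normal subgroup of order prime to
`p` and of `p`-power index. -/
structure IsNormalComplement {G : Type*} [Group G] (p : ℕ) (H : Subgroup G) : Prop where
  normal : H.Normal
  coprime : (Nat.card H).Coprime p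
  index : ∃ n : ℕ, H.index = p ^ n

/-- As a vector space, `K_H^G` is spanned by the sums `(∑_{h ∈ H} h) g` over right cosets. -/
theorem inducedTrivial_restrictScalars {K G : Type*} [Field K] [Group G] [Fintype G]
    (H : Subgroup G) :
    (inducedTrivial K H).restrictScalars K =
      Submodule.span K (Set.range fun g : G => subgroupSum K H * MonoidAlgebra.single g 1) := by
  apply le_antisymm
  · intro x hx
    obtain ⟨a, rfl⟩ := Submodule.mem_span_singleton.1
      (show x ∈ Submodule.span (K[G])ᵐᵒᵖ {subgroupSum K H} from hx)
    induction a using MulOpposite.rec' with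
    | _ a =>
      rw [op_smul_eq_mul]
      induction a using MonoidAlgebra.induction_linear with
      | zero => simp
      | add f g hf hg =>
        rw [mul_add]
        exact add_mem
          (hf (Submodule.smul_mem _ (MulOpposite.op f) (Submodule.mem_span_singleton_self _)))
          (hg (Submodule.smul_mem _ (MulOpposite.op g) (Submodule.mem_span_singleton_self _)))
      | single g r =>
        have : (MonoidAlgebra.single g r : K[G]) = r • MonoidAlgebra.single g 1 := by simp
        rw [this, mul_smul_comm]
        exact Submodule.smul_mem _ _ (Submodule.subset_span ⟨g, rfl⟩)
  · rw [Submodule.span_le]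
    rintro _ ⟨g, rfl⟩
    exact Submodule.smul_mem (inducedTrivial K H) (MulOpposite.op (MonoidAlgebra.single g 1))
      (Submodule.mem_span_singleton_self _)

end GCode

end

/-! Over `𝔽₂` every word satisfies `c * c = c`, so `C ≤ C * C`, which settles one direction.
Conversely, right cosets of `H` are equal or disjoint, so `K_H^G` is closed under `*` and `C ≤ P₀`
gives `C * C ≤ P₀`. The augmentation of `c * d` is `⟨c, d⟩`, so failure of self-orthogonality puts a
word of augmentation `1` into the right ideal `C * C`; a projective cover of the trivial module has
no proper submodule with such a word (`le_of_augmentation_ne_zero`).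

For a normal 2-complement `H`, the sum `e` over `H` is a central idempotent, so `eKG` is projective.
If a submodule `N` misses `e`, the 2-group `G/H` fixes a nonzero linear form on `eKG/N`. An
invariant form is a multiple of the augmentation, so `N` has augmentation zero. -/

namespace GCode

/-! ### Augmentation and projective covers of the trivial module. -/

section Induced

variable {K G : Type*} [Field K] [Group G]

theorem augmentation_single (g : G) (r : K) :
    augmentation K G (MonoidAlgebra.single g r) = r := by
  simp [augmentation]

/-- The augmentation as a homomorphism from the right regular module to the trivial module. -/
noncomputable def augmentationLinear (K G : Type*) [Field K] [Group G] :
    K[G] →ₗ[(K[G])ᵐᵒᵖ] TrivialModule K G where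
  toFun x := (augmentation K G x : K)
  map_add' x y := map_add (augmentation K G) x y
  map_smul' a x :=
    (map_mul (augmentation K G) x a.unop).trans (mul_comm _ _)

/-- The right regular module is projective. -/
theorem projective_regular (R : Type*) [Ring R] : Module.Projective Rᵐᵒᵖ R :=
  Module.Projective.of_equiv
    ({ MulOpposite.opAddEquiv.symm with map_smul' := fun _ _ => rfl } : Rᵐᵒᵖ ≃ₗ[Rᵐᵒᵖ] R)

/-- A subspace closed under right multiplication by group elements is closed under right
multiplication by the group algebra. -/
theorem mul_mem_of_mul_single_mem (S : Submodule K K[G])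
    (hS : ∀ x ∈ S, ∀ g : G, x * MonoidAlgebra.single g 1 ∈ S) {x : K[G]} (hx : x ∈ S)
    (a : K[G]) : x * a ∈ S := by
  induction a using MonoidAlgebra.induction_linear with
  | zero => simp
  | add f g hf hg => rw [mul_add]; exact add_mem hf hg
  | single g r =>
    have : (MonoidAlgebra.single g r : K[G]) = r • MonoidAlgebra.single g 1 := by simp
    rw [this, mul_smul_comm]
    exact S.smul_mem _ (hS x hx g)

/-- A projective cover of the trivial module over `𝔽₂` contained in `KG` has no proper submodule
with an element of augmentation `1`. -/
theorem le_of_augmentation_ne_zero {P : RightIdeal (ZMod 2) G}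
    (hP : IsProjectiveCoverOfTrivial P) {D : RightIdeal (ZMod 2) G} {x : (ZMod 2)[G]}
    (hxP : x ∈ P) (hxD : x ∈ D) (hx : augmentation (ZMod 2) G x ≠ 0) : P ≤ D := by
  obtain ⟨π, hπ⟩ := hP
  -- The trivial module has a single nonzero element, so any `z` lies in `ker f` or differs from `y`
  -- by an element of it.
  have two : ∀ a b : TrivialModule (ZMod 2) G, a ≠ 0 → b = 0 ∨ b - a = 0 :=
    show ∀ a b : ZMod 2, a ≠ 0 → b = 0 ∨ b - a = 0 by decide
  have sup_top : ∀ (f : P →ₗ[((ZMod 2)[G])ᵐᵒᵖ] TrivialModule (ZMod 2) G) (y : P)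
      (N : Submodule ((ZMod 2)[G])ᵐᵒᵖ P), y ∈ N → f y ≠ 0 → LinearMap.ker f ⊔ N = ⊤ := by
    intro f y N hy hfy
    refine eq_top_iff.2 fun z _ => ?_
    rcases two (f y) (f z) hfy with h | h
    · exact Submodule.mem_sup_left h
    · rw [← map_sub] at h
      exact Submodule.mem_sup.2 ⟨z - y, h, y, hy, sub_add_cancel z y⟩
  let f := augmentationLinear (ZMod 2) G ∘ₗ P.subtype
  have hfx : f ⟨x, hxP⟩ ≠ 0 := hx
  -- `f` vanishes on `ker π`, since otherwise its kernel would be everything.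
  have hker : LinearMap.ker f ≤ LinearMap.ker π := by
    by_contra h
    obtain ⟨y, hyf, hyπ⟩ := SetLike.not_le_iff_exists.1 h
    have := hπ.superfluous _ (sup_top π y _ hyf hyπ)
    exact hfx (LinearMap.mem_ker.1 (this ▸ Submodule.mem_top))
  have hπx : π ⟨x, hxP⟩ ≠ 0 := by
    intro h
    have htop : LinearMap.ker π = ⊤ := by
      rw [eq_top_iff, ← sup_top f ⟨x, hxP⟩ (LinearMap.ker π) h hfx]
      exact sup_le hker le_rfl
    obtain ⟨y, hy⟩ := hπ.surjective (show TrivialModule (ZMod 2) G from (1 : ZMod 2))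
    have : π y = 0 := LinearMap.mem_ker.1 (htop ▸ Submodule.mem_top)
    exact (one_ne_zero : (1 : ZMod 2) ≠ 0) (hy.symm.trans this)
  have := hπ.superfluous (D.comap P.subtype) (sup_top π ⟨x, hxP⟩ _ hxD hπx)
  intro y hy
  have hy' : (⟨y, hy⟩ : P) ∈ D.comap P.subtype := this ▸ Submodule.mem_top
  exact hy'

/-! ### Schur products of codes and coset sums. -/

variable [Fintype G]

omit [Group G] in
theorem coeff_schurMul (a b : K[G]) (g : G) :
    (schurMul a b).coeff g = a.coeff g * b.coeff g := by
  classical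
  simp [schurMul, Finsupp.single_apply]

theorem augmentation_schurMul (a b : K[G]) :
    augmentation K G (schurMul a b) = innerProduct a b := by
  simp [schurMul, innerProduct, augmentation_single]

/-- The Schur product as a bilinear map. -/
noncomputable def schurBilin (K G : Type*) [Field K] [Group G] [Fintype G] : K[G] →ₗ[K] K[G] →ₗ[K] K[G] :=
  LinearMap.mk₂ K schurMul
    (fun a b c => by ext g; simp [coeff_schurMul, add_mul])
    (fun r a b => by ext g; simp [coeff_schurMul, mul_assoc])
    (fun a b c => by ext g; simp [coeff_schurMul, mul_add])
    (fun r a b => by ext g; simp [coeff_schurMul, mul_left_comm])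

theorem schurBilin_apply (a b : K[G]) : schurBilin K G a b = schurMul a b := rfl

theorem schurProduct_eq_map₂ (C D : Submodule K K[G]) :
    schurProduct C D = Submodule.map₂ (schurBilin K G) C D := by
  refine le_antisymm (Submodule.span_le.2 ?_) (Submodule.map₂_le.2 ?_)
  · rintro _ ⟨c, hc, d, hd, rfl⟩
    exact Submodule.apply_mem_map₂ _ hc hd
  · exact fun c hc d hd => Submodule.subset_span ⟨c, hc, d, hd, rfl⟩

/-- Right translation only permutes coordinates. This makes the Schur product of two right ideals a
right ideal. -/
theorem schurMul_mul_single (a b : K[G]) (g : G) :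
    schurMul a b * MonoidAlgebra.single g 1 =
      schurMul (a * MonoidAlgebra.single g 1) (b * MonoidAlgebra.single g 1) := by
  ext k
  simp [coeff_schurMul, MonoidAlgebra.coeff_mul_single_apply]

theorem mul_single_mem_schurProduct (C D : RightIdeal K G) (x : K[G])
    (hx : x ∈ schurProduct (C.restrictScalars K) (D.restrictScalars K)) (g : G) :
    x * MonoidAlgebra.single g 1 ∈
      schurProduct (C.restrictScalars K) (D.restrictScalars K) := by
  induction hx using Submodule.span_induction with
  | mem x h =>
    obtain ⟨c, hc, d, hd, rfl⟩ := h
    rw [schurMul_mul_single]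
    exact Submodule.subset_span
      ⟨_, C.smul_mem (MulOpposite.op (MonoidAlgebra.single g 1)) hc,
        _, D.smul_mem (MulOpposite.op (MonoidAlgebra.single g 1)) hd, rfl⟩
  | zero => simp
  | add x y _ _ hx hy => rw [add_mul]; exact add_mem hx hy
  | smul r x _ hx => rw [smul_mul_assoc]; exact Submodule.smul_mem _ _ hx

/-- The Schur product of two `G`-codes as a `G`-code. -/
noncomputable def schurIdeal (C D : RightIdeal K G) : RightIdeal K G where
  carrier := schurProduct (C.restrictScalars K) (D.restrictScalars K)
  add_mem' hx hy := add_mem hx hy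
  zero_mem' := zero_mem _
  smul_mem' a _ hx :=
    mul_mem_of_mul_single_mem _ (mul_single_mem_schurProduct C D) hx a.unop

open Classical in
theorem coeff_subgroupSum (H : Subgroup G) (g : G) :
    (subgroupSum K H).coeff g = if g ∈ H then 1 else 0 := by
  simp [subgroupSum, Finsupp.single_apply]

theorem subgroupSum_mem (H : Subgroup G) : subgroupSum K H ∈ inducedTrivial K H :=
  Submodule.mem_span_singleton_self _

/-- The factors are the indicators of the right cosets `Hg` and `Hk`, which are disjoint or equal.
-/
theorem schurMul_cosetSum (H : Subgroup G) (g k : G) :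
    schurMul (subgroupSum K H * MonoidAlgebra.single g 1)
        (subgroupSum K H * MonoidAlgebra.single k 1) = 0 ∨
      schurMul (subgroupSum K H * MonoidAlgebra.single g 1)
        (subgroupSum K H * MonoidAlgebra.single k 1) =
        subgroupSum K H * MonoidAlgebra.single g 1 := by
  classical
  by_cases h : g * k⁻¹ ∈ H
  · right
    ext x
    have : x * k⁻¹ ∈ H ↔ x * g⁻¹ ∈ H := by
      rw [show x * k⁻¹ = x * g⁻¹ * (g * k⁻¹) by group]
      exact H.mul_mem_cancel_right h
    simp [coeff_schurMul, MonoidAlgebra.coeff_mul_single_apply, coeff_subgroupSum, this]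
  · left
    ext x
    have : x * g⁻¹ ∈ H → x * k⁻¹ ∉ H := fun hg hk => h <| by
      rw [show g * k⁻¹ = (x * g⁻¹)⁻¹ * (x * k⁻¹) by group]
      exact H.mul_mem (H.inv_mem hg) hk
    simpa [coeff_schurMul, MonoidAlgebra.coeff_mul_single_apply, coeff_subgroupSum]
      using fun hk hg => this hg hk

theorem schurProduct_inducedTrivial_le (H : Subgroup G) :
    schurProduct ((inducedTrivial K H).restrictScalars K)
      ((inducedTrivial K H).restrictScalars K) ≤ (inducedTrivial K H).restrictScalars K := by
  rw [schurProduct_eq_map₂, inducedTrivial_restrictScalars, Submodule.map₂_span_span,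
    Submodule.span_le]
  rintro _ ⟨_, ⟨g, rfl⟩, _, ⟨k, rfl⟩, rfl⟩
  simp only [schurBilin_apply]
  rcases schurMul_cosetSum (K := K) H g k with h | h <;> rw [h]
  · exact zero_mem _
  · exact Submodule.subset_span ⟨g, rfl⟩

theorem schurProduct_mono {C C' D D' : Submodule K K[G]} (hC : C ≤ C') (hD : D ≤ D') :
    schurProduct C D ≤ schurProduct C' D' := by
  rw [schurProduct_eq_map₂, schurProduct_eq_map₂]
  exact Submodule.map₂_le_map₂ hC hD

omit [Group G] in
theorem schurMul_self (c : (ZMod 2)[G]) : schurMul c c = c := by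
  ext g
  rw [coeff_schurMul]
  generalize c.coeff g = a
  revert a
  decide

omit [Group G] in
theorem le_schurProduct_self (C : Submodule (ZMod 2) (ZMod 2)[G]) : C ≤ schurProduct C C :=
  fun c hc => Submodule.subset_span ⟨c, hc, c, hc, (schurMul_self c).symm⟩

theorem schurProduct_self_eq_iff {P : RightIdeal (ZMod 2) G}
    (hP : IsProjectiveCoverOfTrivial P) {H : Subgroup G} (hH : P = inducedTrivial (ZMod 2) H)
    {C : RightIdeal (ZMod 2) G} (hC : ¬ IsSelfOrthogonal (C.restrictScalars (ZMod 2))) :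
    schurProduct (C.restrictScalars (ZMod 2)) (C.restrictScalars (ZMod 2)) =
      P.restrictScalars (ZMod 2) ↔ C ≤ P := by
  refine ⟨fun h x hx => ?_, fun h => ?_⟩
  · have : x ∈ P.restrictScalars (ZMod 2) := h ▸ le_schurProduct_self _ hx
    exact this
  · have hle : schurProduct (C.restrictScalars (ZMod 2)) (C.restrictScalars (ZMod 2)) ≤
        P.restrictScalars (ZMod 2) := by
      refine (schurProduct_mono (C' := P.restrictScalars (ZMod 2))
        (D' := P.restrictScalars (ZMod 2)) h h).trans ?_
      rw [hH]
      exact schurProduct_inducedTrivial_le H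
    refine le_antisymm hle ?_
    obtain ⟨c, hc, hcc⟩ := Set.not_subset.1 hC
    simp only [Set.mem_ofPred_eq, not_forall] at hcc
    obtain ⟨d, hd, hcd⟩ := hcc
    have hmem : schurMul c d ∈ schurProduct (C.restrictScalars (ZMod 2))
        (C.restrictScalars (ZMod 2)) := Submodule.subset_span ⟨c, hc, d, hd, rfl⟩
    rw [← augmentation_schurMul] at hcd
    exact le_of_augmentation_ne_zero (D := schurIdeal C C) hP (hle hmem) hmem hcd

/-! ### The sum over a subgroup as a quasi-idempotent. -/

theorem subgroupSum_mul_single_of_mem {H : Subgroup G} {h : G} (hh : h ∈ H) :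
    subgroupSum K H * MonoidAlgebra.single h 1 = subgroupSum K H := by
  classical
  ext x
  simp [MonoidAlgebra.coeff_mul_single_apply, coeff_subgroupSum,
    H.mul_mem_cancel_right (H.inv_mem hh)]

theorem subgroupSum_mul_self (H : Subgroup G) :
    subgroupSum K H * subgroupSum K H = (Nat.card H : K) • subgroupSum K H := by
  classical
  conv_lhs => enter [2]; rw [subgroupSum]
  rw [Finset.mul_sum, Finset.sum_congr rfl fun h hh =>
    subgroupSum_mul_single_of_mem (K := K) (Finset.mem_filter.1 hh).2, Finset.sum_const,
    Nat.cast_smul_eq_nsmul, Nat.card_eq_fintype_card, Fintype.card_subtype]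

theorem augmentation_subgroupSum (H : Subgroup G) :
    augmentation K G (subgroupSum K H) = Nat.card H := by
  classical
  simp [subgroupSum, augmentation_single, Nat.card_eq_fintype_card, Fintype.card_subtype]

theorem subgroupSum_commute_single (H : Subgroup G) [H.Normal] (g : G) :
    MonoidAlgebra.single g 1 * subgroupSum K H =
      subgroupSum K H * MonoidAlgebra.single g 1 := by
  classical
  ext x
  have : g⁻¹ * x ∈ H ↔ x * g⁻¹ ∈ H := Subgroup.Normal.mem_comm_iff ‹_›
  simp [MonoidAlgebra.coeff_mul_single_apply, MonoidAlgebra.coeff_single_mul_apply,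
    coeff_subgroupSum, this]

end Induced

/-! ### Fixed vectors and normal 2-complements. -/

/-- If a finite group acts linearly on a nonzero finite elementary abelian `p`-group through a
quotient of `p`-power order, then there is a nonzero fixed vector. -/
theorem exists_ne_zero_forall_smul_eq {p : ℕ} [Fact p.Prime] {G V : Type*} [Group G]
    [AddCommGroup V] [Finite V] [DistribMulAction G V] {H : Subgroup G} {n : ℕ}
    (hH : H.index = p ^ n) (htriv : ∀ h ∈ H, ∀ v : V, h • v = v)
    {v : V} (hv : v ≠ 0) (hpv : p • v = 0) : ∃ w : V, w ≠ 0 ∧ ∀ g : G, g • w = w := by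
  let φ := MulAction.toPermHom G V
  have hker : H ≤ φ.ker := fun h hh => MonoidHom.mem_ker.2 (Equiv.ext fun v => htriv h hh v)
  have hp : IsPGroup p φ.range := by
    apply IsPGroup.of_card_dvd_pow (n := n)
    rw [← Subgroup.index_ker, ← hH]
    exact Subgroup.index_dvd_of_le hker
  have hdvd : p ∣ Nat.card V := by
    rw [← addOrderOf_eq_prime hpv hv]
    exact addOrderOf_dvd_natCard v
  -- For a `p`-group the number of fixed points is congruent to `|V|`, hence to `0`, mod `p`; since
  -- `0` is fixed, there is another fixed vector.
  have h0 : (0 : V) ∈ MulAction.fixedPoints φ.range V := by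
    rintro ⟨_, g, rfl⟩
    exact smul_zero g
  obtain ⟨w, hw, hne⟩ := hp.exists_fixed_point_of_prime_dvd_card_of_fixed_point V hdvd h0
  exact ⟨w, hne.symm, fun g => hw ⟨φ g, g, rfl⟩⟩

section NormalComplement

variable {G : Type*} [Group G] [Fintype G]

theorem subgroupSum_mul_of_mem {H : Subgroup G} (hodd : (Nat.card H : ZMod 2) = 1)
    {x : (ZMod 2)[G]} (hx : x ∈ inducedTrivial (ZMod 2) H) : subgroupSum (ZMod 2) H * x = x := by
  obtain ⟨a, rfl⟩ := Submodule.mem_span_singleton.1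
    (show x ∈ Submodule.span ((ZMod 2)[G])ᵐᵒᵖ {subgroupSum (ZMod 2) H} from hx)
  induction a using MulOpposite.rec' with
  | _ a => rw [op_smul_eq_mul, ← mul_assoc, subgroupSum_mul_self, hodd, one_smul]

/-- Left multiplication by the idempotent `subgroupSum` retracts `KG` onto `K_H^G`, which is thus a
direct summand. -/
theorem projective_inducedTrivial {H : Subgroup G} (hodd : (Nat.card H : ZMod 2) = 1) :
    Module.Projective ((ZMod 2)[G])ᵐᵒᵖ (inducedTrivial (ZMod 2) H) := by
  have := projective_regular (ZMod 2)[G]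
  let r : (ZMod 2)[G] →ₗ[((ZMod 2)[G])ᵐᵒᵖ] inducedTrivial (ZMod 2) H :=
    { toFun x := ⟨subgroupSum (ZMod 2) H * x,
        Submodule.smul_mem _ (MulOpposite.op x) (subgroupSum_mem H)⟩
      map_add' x y := Subtype.ext (mul_add _ _ _)
      map_smul' a x := Subtype.ext (mul_assoc _ _ _).symm }
  exact Module.Projective.of_split (inducedTrivial (ZMod 2) H).subtype r
    (LinearMap.ext fun x => Subtype.ext (subgroupSum_mul_of_mem hodd x.2))

/-- If `H` is a normal subgroup of odd order and `2`-power index, then every proper subcode of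
`K_H^G` consists of words of augmentation zero. -/
theorem augmentation_eq_zero_of_subgroupSum_notMem {H : Subgroup G} [H.Normal]
    (hodd : (Nat.card H : ZMod 2) = 1) {n : ℕ} (hn : H.index = 2 ^ n)
    {N : RightIdeal (ZMod 2) G} (hN : N ≤ inducedTrivial (ZMod 2) H)
    (he : subgroupSum (ZMod 2) H ∉ N) {x : (ZMod 2)[G]} (hx : x ∈ N) :
    augmentation (ZMod 2) G x = 0 := by
  set e := subgroupSum (ZMod 2) H with e_def
  have hee : e * e = e := by rw [subgroupSum_mul_self, hodd, one_smul]
  -- The linear forms vanishing on `N` and on the complement `(1 - e)KG`.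
  let S : Submodule (ZMod 2) (Module.Dual (ZMod 2) (ZMod 2)[G]) :=
    { carrier := {f | (∀ x ∈ N, f x = 0) ∧ ∀ x, f (e * x) = f x}
      zero_mem' := ⟨fun _ _ => rfl, fun _ => rfl⟩
      add_mem' := fun {f g} hf hg => ⟨fun x hx => by simp [hf.1 x hx, hg.1 x hx],
        fun x => by simp [hf.2 x, hg.2 x]⟩
      smul_mem' := fun c f hf => ⟨fun x hx => by simp [hf.1 x hx], fun x => by simp [hf.2 x]⟩ }
  -- The action is `(g • f) x = f (x g)`; it preserves `S` because `N` is a right ideal and left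
  -- multiplication by `e` commutes with right translation.
  let _ : DistribMulAction G S :=
    { smul g f := ⟨f.1 ∘ₗ LinearMap.mulRight (ZMod 2) (MonoidAlgebra.single g 1),
        fun x hx => f.2.1 _ (N.smul_mem (MulOpposite.op (MonoidAlgebra.single g 1)) hx),
        fun x => by simpa [mul_assoc] using f.2.2 (x * MonoidAlgebra.single g 1)⟩
      one_smul f := Subtype.ext <| LinearMap.ext fun x =>
        congrArg f.1 (mul_one x)
      mul_smul g k f := Subtype.ext <| LinearMap.ext fun x => congrArg f.1 <| by
        simp [mul_assoc, MonoidAlgebra.single_mul_single]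
      smul_zero g := rfl
      smul_add g f k := rfl }
  have smul_apply (g : G) (f : S) (x : (ZMod 2)[G]) :
      (g • f).1 x = f.1 (x * MonoidAlgebra.single g 1) := rfl
  have htriv : ∀ h ∈ H, ∀ f : S, h • f = f := by
    refine fun h hh f => Subtype.ext (LinearMap.ext fun x => ?_)
    -- Normality makes `e` central, whence `f (xh) = f (exh) = f (xeh) = f (xe) = f (x)`.
    have hcomm : e * x = x * e := by
      induction x using MonoidAlgebra.induction_linear with
      | zero => simp
      | add x y hx hy => rw [mul_add, add_mul, hx, hy]
      | single g r =>
        have : (MonoidAlgebra.single g r : (ZMod 2)[G]) = r • MonoidAlgebra.single g 1 := by simp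
        rw [this, mul_smul_comm, smul_mul_assoc, subgroupSum_commute_single]
    rw [smul_apply, ← f.2.2 (x * _), ← mul_assoc, hcomm, mul_assoc,
      subgroupSum_mul_single_of_mem hh, ← e_def, ← hcomm, f.2.2]
  -- A form separating `e` from `N`, precomposed with left multiplication by `e`, is a nonzero
  -- element of `S`.
  obtain ⟨f₀, hf₀, hf₀N⟩ :=
    Submodule.exists_le_ker_of_notMem (p := N.restrictScalars (ZMod 2)) (v := e) he
  let f₁ : S := ⟨f₀ ∘ₗ LinearMap.mulLeft (ZMod 2) e, fun x hx => by
    rw [LinearMap.comp_apply, LinearMap.mulLeft_apply, subgroupSum_mul_of_mem hodd (hN hx)]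
    exact hf₀N hx, fun x => by simp [← mul_assoc, hee]⟩
  have hf₁ : f₁ ≠ 0 := fun h => hf₀ <| by
    have := congrArg (fun f : S => f.1 e) h
    simpa [f₁, hee] using this
  have : Finite (ZMod 2)[G] := .of_injective (fun x => (x.coeff : G → ZMod 2))
    (DFunLike.coe_injective.comp MonoidAlgebra.coeff_injective)
  have : Finite (Module.Dual (ZMod 2) (ZMod 2)[G]) := DFunLike.finite _
  have htwo : 2 • f₁ = 0 := by
    rw [← Nat.cast_smul_eq_nsmul (ZMod 2) 2 f₁]
    exact zero_smul _ _
  obtain ⟨f, hf, hfix⟩ := exists_ne_zero_forall_smul_eq hn htriv hf₁ htwo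
  -- Invariance gives `f g = f 1` for all `g`, so `f` is a multiple of the augmentation.
  have key (y : (ZMod 2)[G]) : f.1 y = augmentation (ZMod 2) G y * f.1 1 := by
    induction y using MonoidAlgebra.induction_linear with
    | zero => simp
    | add x y hx hy => rw [map_add, map_add, add_mul, hx, hy]
    | single g r =>
      have : (MonoidAlgebra.single g r : (ZMod 2)[G]) = r • (1 * MonoidAlgebra.single g 1) := by
        simp
      rw [augmentation_single, this, map_smul, ← smul_apply, hfix, smul_eq_mul]
  have hf1 : f.1 1 ≠ 0 := fun h => hf (Subtype.ext (LinearMap.ext fun y => by simp [key y, h]))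
  exact (mul_eq_zero.1 ((key x).symm.trans (f.2.1 x hx))).resolve_right hf1

theorem isProjectiveCoverOfTrivial_inducedTrivial {H : Subgroup G}
    (hH : IsNormalComplement 2 H) :
    IsProjectiveCoverOfTrivial (inducedTrivial (ZMod 2) H) := by
  have := hH.normal
  obtain ⟨n, hn⟩ := hH.index
  have hodd : (Nat.card H : ZMod 2) = 1 :=
    ZMod.natCast_eq_one_iff_odd.2 (Nat.coprime_two_right.1 hH.coprime)
  set P := inducedTrivial (ZMod 2) H with P_def
  let e : P := ⟨subgroupSum (ZMod 2) H, subgroupSum_mem H⟩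
  let π := augmentationLinear (ZMod 2) G ∘ₗ P.subtype
  have hπe : π e = (show TrivialModule (ZMod 2) G from (1 : ZMod 2)) :=
    (augmentation_subgroupSum (K := ZMod 2) H).trans hodd
  have hsurj (a : ZMod 2) : ∃ y : P, π y = (show TrivialModule (ZMod 2) G from a) := by
    refine ⟨MulOpposite.op (MonoidAlgebra.single (1 : G) a) • e, ?_⟩
    rw [map_smul, hπe]
    exact (mul_one _).trans (augmentation_single 1 a)
  refine ⟨π, projective_inducedTrivial hodd, hsurj, fun N hN => ?_⟩
  -- Either `N` contains the generator `e` and is everything, or `N ≤ ker π`; then `ker π` would be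
  -- everything, although `π e = 1`.
  · by_cases he : subgroupSum (ZMod 2) H ∈ N.map P.subtype
    · obtain ⟨y, hy, hye⟩ := he
      refine eq_top_iff.2 fun x _ => ?_
      have hx : x = MulOpposite.op x.1 • y := Subtype.ext <| by
        change x.1 = P.subtype y * x.1
        rw [hye, subgroupSum_mul_of_mem hodd x.2]
      rw [hx]
      exact N.smul_mem _ hy
    · have hle : N ≤ LinearMap.ker π := fun x hx =>
        augmentation_eq_zero_of_subgroupSum_notMem hodd hn (Submodule.map_subtype_le P N) he
          (Submodule.mem_map_of_mem (f := P.subtype) hx)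
      rw [sup_eq_left.2 hle] at hN
      have : π e = 0 := LinearMap.mem_ker.1 (hN ▸ Submodule.mem_top)
      exact absurd (hπe.symm.trans this) (one_ne_zero : (1 : ZMod 2) ≠ 0)

end NormalComplement

end GCode

theorem proposition3p7 {G : Type*} [Group G] [Fintype G] :
    (∀ H : Subgroup G, GCode.IsNormalComplement 2 H →
      GCode.IsProjectiveCoverOfTrivial (GCode.inducedTrivial (ZMod 2) H)) ∧
    (∀ (P₀ : GCode.RightIdeal (ZMod 2) G), GCode.IsProjectiveCoverOfTrivial P₀ →
      (∃ H : Subgroup G, P₀ = GCode.inducedTrivial (ZMod 2) H) →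
      ∀ C : GCode.RightIdeal (ZMod 2) G,
        ¬ GCode.IsSelfOrthogonal (C.restrictScalars (ZMod 2)) →
        (GCode.schurProduct (C.restrictScalars (ZMod 2)) (C.restrictScalars (ZMod 2)) =
            P₀.restrictScalars (ZMod 2) ↔
          C ≤ P₀)) := by
  refine ⟨fun H hH => GCode.isProjectiveCoverOfTrivial_inducedTrivial hH, ?_⟩
  rintro P hP ⟨H, hH⟩ C hC
  exact GCode.schurProduct_self_eq_iff hP hH hC
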